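/- Let $X$ be a uniform space with a basepoint $*\in X$. For a set $E\subset X\times X$, an $E$-chain is a finite sequence $\{x_0,\dots,x_n\}$ ($n\ge 0$) of points with $(x_i,x_{i+1})\in E$ for all $i$. Two $E$-chains starting at $*$ are $E$-homotopic if one is obtained from the other by finitely many moves, each of which adds or takes away a single point, keeps the first and the last point of the chain unchanged, and results in an $E$-chain (in particular $\{*\}$ may be replaced by $\{*,*\}$ when $(*,*)\in E$). For an entourage $E$ of $X$, let $X_E$ be the set of $E$-homotopy classes $[\alpha]_E$ of $E$-chains $\alpha$ starting at $*$, with the uniform structure that has as a basis the sets $$F^{*}=\{([x_0,\dots,x_{n-1},x]_E,[x_0,\dots,x_{n-1},y]_E) : (x,y)\in F\},$$ where $F\subset E$ runs over the entourages of $X$ and both chains are $E$-chains from $*$. For entourages $F\subset E$ let $\phi_{EF}:X_F\to X_E$, $[\alpha]_F\mapsto[\alpha]_E$. Let $\widetilde X$ be the inverse limit of the system $(X_E,\phi_{EF})$ over all entourages of $X$, with projections $\phi_E:\widetilde X\to X_E$ and endpoint mapping $\phi:\widetilde X\to X$. A covering basis is a basis of the uniform structure of $X$ consisting of entourages $E$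 for which $\phi_E$ is surjective; a covering entourage is an element of some covering basis. $X$ is coverable if $\phi$ is surjective and $X$ has a covering basis. A uniform space $Y$ is chain connected if for every entourage $D$ of $Y$ every pair of points of $Y$ is joined by a $D$-chain. **Corollary.** If $X$ is coverable, then an entourage $E$ of $X$ is a covering entourage if and only if $X_E$ is chain connected. -/

import Mathlib

open Set Filter Uniformity

namespace Coverable

universe u

variable {X : Type u}

/-- An `E`-chain `{x₀, x₁, …, xₙ}` starting at `x₀`: a non-empty finite sequence of points with
first point `x₀` such that `(xᵢ, xᵢ₊₁) ∈ E` for all `i`. -/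
@[ext]
structure EChain (E : Set (X × X)) (x₀ : X) where
  pts : List X
  head_eq : pts.head? = some x₀
  isChain : pts.IsChain (fun x y => (x, y) ∈ E)

namespace EChain

variable {E : Set (X × X)} {x₀ : X}

theorem ne_nil (α : EChain E x₀) : α.pts ≠ [] := by
  intro h
  have := α.head_eq
  simp [h] at this

/-- The last point `xₙ` of a chain. -/
def endpoint (α : EChain E x₀) : X := α.pts.getLast α.ne_nil

/-- `β` is obtained from `α` by adding one point, without changing the endpoints (both `α` and `β`
are `E`-chains from `x₀`, so that their first points agree automatically). For a chain with at
least two points this is the same as inserting a point between two consecutive ones; for a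
one-point chain it says that `{x₀}` may be replaced by `{x₀, x₀}`. -/
def AddsPoint (α β : EChain E x₀) : Prop :=
  (∃ (p q : List X) (x : X), α.pts = p ++ q ∧ β.pts = p ++ x :: q) ∧ α.endpoint = β.endpoint

/-- `E`-homotopy of `E`-chains: a finite sequence of moves, each of which adds or takes away one
point, keeps the endpoints and results in an `E`-chain. -/
def homotopySetoid (E : Set (X × X)) (x₀ : X) : Setoid (EChain E x₀) :=
  Relation.EqvGen.setoid AddsPoint

theorem endpoint_eq_of_homotopic {α β : EChain E x₀} (h : homotopySetoid E x₀ α β) :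
    α.endpoint = β.endpoint := by
  induction (h : Relation.EqvGen AddsPoint α β) with
  | rel _ _ h => exact h.2
  | refl => rfl
  | symm _ _ _ ih => exact ih.symm
  | trans _ _ _ _ _ h₁ h₂ => exact h₁.trans h₂

/-- An `F`-chain considered as an `E`-chain, for `F ⊆ E`. -/
def map {F : Set (X × X)} (h : F ⊆ E) (α : EChain F x₀) : EChain E x₀ :=
  ⟨α.pts, α.head_eq, α.isChain.imp fun _ _ hxy => h hxy⟩

theorem map_homotopic {F : Set (X × X)} (h : F ⊆ E) {α β : EChain F x₀}
    (hαβ : homotopySetoid F x₀ α β) : homotopySetoid E x₀ (α.map h) (β.map h) := by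
  induction (hαβ : Relation.EqvGen AddsPoint α β) with
  | rel _ _ h => exact Relation.EqvGen.rel _ _ h
  | refl => exact Relation.EqvGen.refl _
  | symm _ _ _ ih => exact Relation.EqvGen.symm _ _ ih
  | trans _ _ _ _ _ h₁ h₂ => exact Relation.EqvGen.trans _ _ _ h₁ h₂

/-- Append a point to a chain. -/
def snoc (α : EChain E x₀) (w : X) (h : (α.endpoint, w) ∈ E) : EChain E x₀ where
  pts := α.pts ++ [w]
  head_eq := by simp [List.head?_append, α.head_eq]
  isChain := by
    refine List.isChain_append.2 ⟨α.isChain, by simp, fun x hx y hy => ?_⟩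
    rw [List.getLast?_eq_getLast_of_ne_nil α.ne_nil] at hx
    simp only [Option.mem_def, Option.some.injEq, List.head?_cons] at hx hy
    subst hx hy
    exact h

theorem endpoint_snoc (α : EChain E x₀) (w : X) (h : (α.endpoint, w) ∈ E) :
    (α.snoc w h).endpoint = w := by
  simp [endpoint, snoc]

theorem snoc_homotopic {α β : EChain E x₀} (hαβ : homotopySetoid E x₀ α β) (w : X)
    (hα : (α.endpoint, w) ∈ E) (hβ : (β.endpoint, w) ∈ E) :
    homotopySetoid E x₀ (α.snoc w hα) (β.snoc w hβ) := by
  induction (hαβ : Relation.EqvGen AddsPoint α β) with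
  | rel α β h =>
    obtain ⟨⟨p, q, x, h₁, h₂⟩, _⟩ := h
    refine Relation.EqvGen.rel _ _ ⟨⟨p, q ++ [w], x, ?_, ?_⟩, ?_⟩
    · simp [snoc, h₁]
    · simp [snoc, h₂]
    · simp [endpoint_snoc]
  | refl => exact Relation.EqvGen.refl _
  | symm α β h ih => exact Relation.EqvGen.symm _ _ (ih hβ hα)
  | trans α β γ h₁ h₂ ih₁ ih₂ =>
    have hm : (β.endpoint, w) ∈ E := by
      rw [← endpoint_eq_of_homotopic h₁]; exact hα
    exact Relation.EqvGen.trans _ _ _ (ih₁ hα hm) (ih₂ hm hβ)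

/-- A chain is homotopic to the chain that repeats its last point. -/
theorem homotopic_snoc_self (α : EChain E x₀) (h : (α.endpoint, α.endpoint) ∈ E) :
    homotopySetoid E x₀ α (α.snoc α.endpoint h) :=
  Relation.EqvGen.rel _ _ ⟨⟨α.pts, [], α.endpoint, by simp, by simp [snoc]⟩,
    (endpoint_snoc α _ h).symm⟩

end EChain

variable [UniformSpace X]

/-- The entourages of a uniform space. -/
abbrev Entourage (X : Type u) [UniformSpace X] : Type u := {E : Set (X × X) // E ∈ 𝓤 X}

/-- The set `X_E` of `E`-homotopy classes `[α]_E` of `E`-chains `α` starting at the basepoint. -/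
def XE (E : Entourage X) (x₀ : X) : Type u := Quotient (EChain.homotopySetoid E.1 x₀)

namespace XE

variable {x₀ : X}

/-- The class `[α]_E`. -/
def mk (E : Entourage X) (α : EChain E.1 x₀) : XE E x₀ :=
  Quotient.mk (EChain.homotopySetoid E.1 x₀) α

theorem mk_eq {E : Entourage X} {α β : EChain E.1 x₀} :
    mk E α = mk E β ↔ EChain.homotopySetoid E.1 x₀ α β :=
  Quotient.eq

/-- The endpoint mapping `φ_{XE} : X_E → X`. -/
def endpoint (E : Entourage X) : XE E x₀ → X :=
  Quotient.lift EChain.endpoint fun _ _ h => EChain.endpoint_eq_of_homotopic h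

/-- The mapping `φ_{EF} : X_F → X_E`, `[α]_F ↦ [α]_E`, for entourages `F ⊆ E`. -/
def map {E F : Entourage X} (h : F.1 ⊆ E.1) : XE F x₀ → XE E x₀ :=
  Quotient.map (EChain.map h) fun _ _ hαβ => EChain.map_homotopic h hαβ

theorem endpoint_map {E F : Entourage X} (h : F.1 ⊆ E.1) (a : XE F x₀) :
    endpoint E (map h a) = endpoint F a := by
  induction a using Quotient.inductionOn
  rfl

/-- The set `F*` of all pairs `([x₀, …, xₙ₋₁, x]_E, [x₀, …, xₙ₋₁, y]_E)` with `(x, y) ∈ F`. -/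
def star (E : Entourage X) (x₀ : X) (F : Set (X × X)) : Set (XE E x₀ × XE E x₀) :=
  {p | ∃ (α β : EChain E.1 x₀) (l : List X) (x y : X),
    α.pts = l ++ [x] ∧ β.pts = l ++ [y] ∧ (x, y) ∈ F ∧ p = (mk E α, mk E β)}

theorem star_mono (E : Entourage X) (x₀ : X) {F G : Set (X × X)} (h : F ⊆ G) :
    star E x₀ F ⊆ star E x₀ G := by
  rintro _ ⟨α, β, l, x, y, hα, hβ, hF, rfl⟩
  exact ⟨α, β, l, x, y, hα, hβ, h hF, rfl⟩

theorem star_comp (E : Entourage X) (x₀ : X) {F G : Set (X × X)} (hF : F ⊆ E.1) (hG : G ⊆ E.1)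
    (hGF : ∀ x y z, (x, y) ∈ G → (y, z) ∈ G → (x, z) ∈ F) {a b c : XE E x₀}
    (hab : (a, b) ∈ star E x₀ G) (hbc : (b, c) ∈ star E x₀ G) : (a, c) ∈ star E x₀ F := by
  have hrefl : ∀ z, (z, z) ∈ E.1 := fun z => refl_mem_uniformity E.2
  obtain ⟨α, β, l, x, y, hα, hβ, hxy, h₁⟩ := hab
  obtain ⟨β', γ, m, y', w, hβ', hγ, hyw, h₂⟩ := hbc
  obtain ⟨rfl, rfl⟩ := Prod.mk.inj h₁
  obtain ⟨hb, rfl⟩ := Prod.mk.inj h₂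
  have eα : α.endpoint = x := by simp [EChain.endpoint, hα]
  have eβ : β.endpoint = y := by simp [EChain.endpoint, hβ]
  have eβ' : β'.endpoint = y' := by simp [EChain.endpoint, hβ']
  have eγ : γ.endpoint = w := by simp [EChain.endpoint, hγ]
  have hom := mk_eq.1 hb
  have hy : y = y' := by rw [← eβ, ← eβ']; exact EChain.endpoint_eq_of_homotopic hom
  subst hy
  have hw : (y, w) ∈ E.1 := hG hyw
  have hxE : (x, y) ∈ E.1 := hG hxy
  have hxw : (x, w) ∈ F := hGF _ _ _ hxy hyw
  have s₁ : EChain.homotopySetoid E.1 x₀ γ (β'.snoc w (by rw [eβ']; exact hw)) := by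
    refine Relation.EqvGen.rel _ _ ⟨⟨m, [w], y, hγ, by simp [EChain.snoc, hβ']⟩, ?_⟩
    rw [EChain.endpoint_snoc, eγ]
  have s₂ := EChain.snoc_homotopic hom w (by rw [eβ]; exact hw) (by rw [eβ']; exact hw)
  have e₂ : (α.snoc y (by rw [eα]; exact hxE)).endpoint = y := EChain.endpoint_snoc _ _ _
  have s₃ : EChain.homotopySetoid E.1 x₀ (β.snoc w (by rw [eβ]; exact hw))
      ((α.snoc y (by rw [eα]; exact hxE)).snoc w (by rw [e₂]; exact hw)) := by
    refine Relation.EqvGen.rel _ _ ⟨⟨l, [y, w], x, ?_, ?_⟩, ?_⟩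
    · simp [EChain.snoc, hβ]
    · simp [EChain.snoc, hα]
    · simp [EChain.endpoint_snoc]
  have s₄ : EChain.homotopySetoid E.1 x₀ (α.snoc w (by rw [eα]; exact hF hxw))
      ((α.snoc y (by rw [eα]; exact hxE)).snoc w (by rw [e₂]; exact hw)) := by
    refine Relation.EqvGen.rel _ _ ⟨⟨l ++ [x], [w], y, ?_, ?_⟩, ?_⟩
    · simp [EChain.snoc, hα]
    · simp [EChain.snoc, hα]
    · simp [EChain.endpoint_snoc]
  refine ⟨α.snoc α.endpoint (hrefl _), α.snoc w (by rw [eα]; exact hF hxw), l ++ [x], x, w,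
    ?_, ?_, hxw, ?_⟩
  · simp [EChain.snoc, hα, eα]
  · simp [EChain.snoc, hα]
  · refine Prod.ext (mk_eq.2 (α.homotopic_snoc_self _)) (mk_eq.2 ?_)
    exact Setoid.trans' _ s₁ (Setoid.trans' _ (Setoid.symm' _ s₂)
      (Setoid.trans' _ s₃ (Setoid.symm' _ s₄)))

/-- The sets `F*`, for entourages `F ⊆ E`, as a filter basis. -/
def starBasis (E : Entourage X) (x₀ : X) : FilterBasis (XE E x₀ × XE E x₀) where
  sets := {S | ∃ F ∈ 𝓤 X, F ⊆ E.1 ∧ S = star E x₀ F}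
  nonempty := ⟨_, E.1, E.2, Subset.rfl, rfl⟩
  inter_sets := by
    rintro _ _ ⟨F, hF, hFE, rfl⟩ ⟨G, hG, _, rfl⟩
    exact ⟨_, ⟨F ∩ G, inter_mem hF hG, inter_subset_left.trans hFE, rfl⟩,
      subset_inter (star_mono E x₀ inter_subset_left) (star_mono E x₀ inter_subset_right)⟩

/-- The natural uniform structure on `X_E`: the sets `F*` with `F ⊆ E` an entourage are a basis. -/
instance uniformSpace (E : Entourage X) (x₀ : X) : UniformSpace (XE E x₀) :=
  UniformSpace.ofCore <| UniformSpace.Core.mkOfBasis (starBasis E x₀)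
    (by
      rintro _ ⟨F, hF, _, rfl⟩ a
      induction a using Quotient.inductionOn with
      | h α =>
        have h := (List.dropLast_append_getLast α.ne_nil).symm
        exact ⟨α, α, _, _, _, h, h, refl_mem_uniformity hF, rfl⟩)
    (by
      rintro _ ⟨F, hF, hFE, rfl⟩
      refine ⟨_, ⟨F ∩ Prod.swap ⁻¹' F, inter_mem hF (symm_le_uniformity hF),
        inter_subset_left.trans hFE, rfl⟩, ?_⟩
      rintro _ ⟨α, β, l, x, y, hα, hβ, h, rfl⟩
      exact ⟨β, α, l, y, x, hβ, hα, h.2, rfl⟩)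
    (by
      rintro _ ⟨F, hF, hFE, rfl⟩
      obtain ⟨G, hG, hGF⟩ := comp_mem_uniformity_sets hF
      refine ⟨_, ⟨G ∩ F, inter_mem hG hF, inter_subset_right.trans hFE, rfl⟩, ?_⟩
      rintro ⟨a, c⟩ ⟨b, hab, hbc⟩
      exact star_comp E x₀ hFE (inter_subset_right.trans hFE)
        (fun x y z hxy hyz => hGF ⟨y, hxy.1, hyz.1⟩) hab hbc)

theorem hasBasis_uniformity (E : Entourage X) (x₀ : X) :
    (𝓤 (XE E x₀)).HasBasis (fun F : Set (X × X) => F ∈ 𝓤 X ∧ F ⊆ E.1) (star E x₀) := by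
  refine ⟨fun t => ((starBasis E x₀).mem_filter_iff).trans ⟨?_, ?_⟩⟩
  · rintro ⟨_, ⟨F, hF, hFE, rfl⟩, h⟩
    exact ⟨F, ⟨hF, hFE⟩, h⟩
  · rintro ⟨F, ⟨hF, hFE⟩, h⟩
    exact ⟨_, ⟨F, hF, hFE, rfl⟩, h⟩

end XE

/-- A uniform space is chain connected if every pair of its points is joined by an `E`-chain, for
every entourage `E`. -/
def ChainConnected (Y : Type u) [UniformSpace Y] : Prop :=
  ∀ E ∈ 𝓤 Y, ∀ x y : Y, ∃ α : EChain E x, α.endpoint = y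

/-- The underlying set of `X̃`, the inverse limit of the fundamental inverse system
`(X_E, φ_{EF})` indexed on all entourages of `X`. -/
def XTilde (x₀ : X) : Type u :=
  {a : (E : Entourage X) → XE E x₀ // ∀ (E F : Entourage X) (h : F.1 ⊆ E.1),
    XE.map h (a F) = a E}

namespace XTilde

variable {x₀ : X}

/-- The natural projection `φ_E : X̃ → X_E`. -/
def proj (E : Entourage X) (a : XTilde x₀) : XE E x₀ := a.1 E

/-- The natural projection `φ : X̃ → X`, that is, the endpoint mapping. -/
def endpoint (a : XTilde x₀) : X := XE.endpoint ⟨univ, univ_mem⟩ (proj ⟨univ, univ_mem⟩ a)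

theorem endpoint_proj (E : Entourage X) (a : XTilde x₀) :
    XE.endpoint E (proj E a) = endpoint a := by
  have h := a.2 ⟨univ, univ_mem⟩ E (subset_univ _)
  have h' := XE.endpoint_map (E := ⟨univ, univ_mem⟩) (subset_univ E.1) (proj E a)
  rw [← h', endpoint]
  exact congrArg _ h

end XTilde

/-- A covering basis (with respect to the basepoint `x₀`): a basis of the uniform structure of `X`
such that `φ_E : X̃ → X_E` is surjective for every member `E` of it. -/
def IsCoveringBasis (x₀ : X) (B : Set (Entourage X)) : Prop :=
  (𝓤 X).HasBasis (fun E : Entourage X => E ∈ B) (fun E => E.1) ∧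
    ∀ E ∈ B, Function.Surjective (XTilde.proj E : XTilde x₀ → XE E x₀)

/-- `X`, with basepoint `x₀`, is coverable: `φ : X̃ → X` is surjective and `X` has a covering
basis. -/
def IsCoverable (x₀ : X) : Prop :=
  Function.Surjective (XTilde.endpoint : XTilde x₀ → X) ∧
    ∃ B : Set (Entourage X), IsCoveringBasis x₀ B

/-- A covering entourage: an element of a covering basis. -/
def IsCoveringEntourage (x₀ : X) (E : Entourage X) : Prop :=
  ∃ B : Set (Entourage X), IsCoveringBasis x₀ B ∧ E ∈ B

end Coverable

open Coverable

/-! For entourages `F ⊆ E`, the image of `φ_{EF}` is exactly the set of points of `X_E` that an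
`F*`-chain joins to the class of `{*}`. Consecutive initial segments of an `F`-chain are `F*`-close
(`XE.reflTransGen_star_mk_map`); conversely, each `F*`-step can be realised by appending an
`F`-close point to a representative (`XE.exists_snoc_of_mem_star`). As the `F*` form a basis, `X_E`
is chain connected iff every `φ_{EF}` is surjective. If `φ_E` is surjective, so is each `φ_{EF}`,
because `φ_E = φ_{EF} ∘ φ_F`. Conversely, take `F ⊆ E` in a covering basis: both factors are then
surjective, hence so is `φ_E`, and `E` may be added to that basis. -/

namespace Coverable

universe v

/-! ### Chains and chain connectedness -/

namespace EChain

variable {Y : Type v} {D : Set (Y × Y)} {y₀ : Y}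

/-- The one-point chain. -/
def single (D : Set (Y × Y)) (y₀ : Y) : EChain D y₀ := ⟨[y₀], rfl, List.isChain_singleton _⟩

theorem endpoint_single : (single D y₀).endpoint = y₀ := rfl

/-- Every chain is obtained from the one-point chain by appending points. -/
theorem snoc_induction {P : EChain D y₀ → Prop} (single : P (single D y₀))
    (snoc : ∀ (α : EChain D y₀) (w : Y) (h : (α.endpoint, w) ∈ D), P α → P (α.snoc w h))
    (α : EChain D y₀) : P α := by
  obtain ⟨l, h₁, h₂⟩ := α
  induction l using List.reverseRecOn with
  | nil => simp at h₁
  | append_singleton l w ih =>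
    rcases eq_or_ne l [] with rfl | hl
    · obtain rfl : w = y₀ := by simpa using h₁
      exact single
    · have hh : l.head? = some y₀ := by
        rw [← h₁, List.head?_append_of_ne_nil _ hl]
      obtain ⟨hc, -, hlast⟩ := List.isChain_append.1 h₂
      exact snoc ⟨l, hh, hc⟩ w
        (hlast _ (by rw [List.getLast?_eq_getLast_of_ne_nil hl]; rfl) _ (by simp)) (ih hh hc)

/-- Reduces concatenation, reversal and enlargement of chains to standard facts on reflexive
transitive closures. -/
theorem exists_endpoint_eq_iff {z : Y} :
    (∃ α : EChain D y₀, α.endpoint = z) ↔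
      Relation.ReflTransGen (fun a b => (a, b) ∈ D) y₀ z := by
  constructor
  · rintro ⟨α, rfl⟩
    induction α using snoc_induction with
    | single => exact .refl
    | snoc α w h ih => rw [endpoint_snoc]; exact ih.tail h
  · intro h
    induction h with
    | refl => exact ⟨single D y₀, rfl⟩
    | @tail b c _ hbc ih =>
      obtain ⟨α, rfl⟩ := ih
      exact ⟨α.snoc c hbc, endpoint_snoc _ _ _⟩

end EChain

variable {X : Type v} [UniformSpace X] {x₀ : X} {E : Entourage X}

theorem chainConnected_iff {Y : Type v} [UniformSpace Y] :
    ChainConnected Y ↔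
      ∀ D ∈ 𝓤 Y, ∀ x y : Y, Relation.ReflTransGen (fun a b => (a, b) ∈ D) x y := by
  simp only [ChainConnected, EChain.exists_endpoint_eq_iff]

/-- To verify chain connectedness it suffices to join a single point to all others, for the members
of a basis. -/
theorem chainConnected_of_hasBasis {Y : Type v} [UniformSpace Y] {ι : Sort*} {p : ι → Prop}
    {s : ι → Set (Y × Y)} (hs : (𝓤 Y).HasBasis p s) (y₀ : Y)
    (h : ∀ i, p i → ∀ y, Relation.ReflTransGen (fun a b => (a, b) ∈ s i) y₀ y) :
    ChainConnected Y := by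
  refine chainConnected_iff.2 fun D hD x y => ?_
  have key : ∀ D' ∈ 𝓤 Y, ∀ z, Relation.ReflTransGen (fun a b => (a, b) ∈ D') y₀ z := by
    intro D' hD' z
    obtain ⟨i, hi, hiD⟩ := hs.mem_iff.1 hD'
    exact Relation.ReflTransGen.mono (fun _ _ hab => hiD hab) _ _ (h i hi z)
  -- A path from `y₀` to `x` for the swapped entourage is a `D`-path from `x` to `y₀` read
  -- backwards.
  exact (Relation.reflTransGen_swap.1 (key _ (symm_le_uniformity hD) x)).trans (key D hD y)

/-! ### `F`-chains in `X` versus `F*`-chains in `X_E` -/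

namespace XE

/-- The initial segments of an `F`-chain form an `F*`-chain. -/
theorem reflTransGen_star_mk_map {F : Set (X × X)} (hF : F ∈ 𝓤 X) (h : F ⊆ E.1)
    (β : EChain F x₀) :
    Relation.ReflTransGen (fun a b => (a, b) ∈ star E x₀ F)
      (mk E (EChain.single E.1 x₀)) (mk E (β.map h)) := by
  induction β using EChain.snoc_induction with
  | single => exact .refl
  | snoc β w hw ih =>
    have hrefl : (β.endpoint, β.endpoint) ∈ F := refl_mem_uniformity hF
    -- Pairs in `F*` differ only in their last point, so `β` is first lengthened by repeating its
    -- endpoint, which does not change its class.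
    refine ih.tail ⟨(β.map h).snoc β.endpoint (h hrefl), (β.map h).snoc w (h hw), β.pts,
      β.endpoint, w, rfl, rfl, hw, Prod.ext (mk_eq.2 ?_) rfl⟩
    exact (β.map h).homotopic_snoc_self (h hrefl)

/-- An `F*`-neighbour of the class of `α` is represented by a chain that extends `α` by an
`F`-close point. -/
theorem exists_snoc_of_mem_star {F : Set (X × X)} (h : F ⊆ E.1) {α : EChain E.1 x₀} {b : XE E x₀}
    (hb : (mk E α, b) ∈ star E x₀ F) :
    ∃ (y : X) (hy : (α.endpoint, y) ∈ F), mk E (α.snoc y (h hy)) = b := by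
  obtain ⟨γ, δ, l, x, y, hγ, hδ, hxy, heq⟩ := hb
  obtain ⟨hαγ, rfl⟩ := Prod.mk.inj heq
  have eγ : γ.endpoint = x := by simp [EChain.endpoint, hγ]
  have hom := mk_eq.1 hαγ
  have eα : α.endpoint = x := (EChain.endpoint_eq_of_homotopic hom).trans eγ
  have hα : (α.endpoint, y) ∈ F := by rwa [eα]
  have hγy : (γ.endpoint, y) ∈ E.1 := by rw [eγ]; exact h hxy
  refine ⟨y, hα, mk_eq.2 (Setoid.trans' _ (EChain.snoc_homotopic hom y (h hα) hγy) ?_)⟩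
  -- Removing `x` from `l, x, y` (which is `γ` with `y` appended) leaves `l, y`, which is `δ`.
  refine Setoid.symm' _ (Relation.EqvGen.rel _ _ ⟨⟨l, [y], x, hδ, by simp [EChain.snoc, hγ]⟩, ?_⟩)
  rw [EChain.endpoint_snoc]
  simp [EChain.endpoint, hδ]

/-- A class that is joined to the basepoint by an `F*`-chain is represented by an `F`-chain. -/
theorem exists_mk_map_eq_of_reflTransGen {F : Set (X × X)} (h : F ⊆ E.1) {a : XE E x₀}
    (ha : Relation.ReflTransGen (fun a b => (a, b) ∈ star E x₀ F)
      (mk E (EChain.single E.1 x₀)) a) :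
    ∃ β : EChain F x₀, mk E (β.map h) = a := by
  induction ha with
  | refl => exact ⟨EChain.single F x₀, rfl⟩
  | tail _ hbc ih =>
    obtain ⟨β, rfl⟩ := ih
    obtain ⟨y, hy, rfl⟩ := exists_snoc_of_mem_star h hbc
    exact ⟨β.snoc y hy, rfl⟩

theorem map_surjective_of_chainConnected (hE : ChainConnected (XE E x₀)) {F : Entourage X}
    (h : F.1 ⊆ E.1) : Function.Surjective (map h : XE F x₀ → XE E x₀) := by
  intro a
  obtain ⟨β, hβ⟩ := exists_mk_map_eq_of_reflTransGen h
    (chainConnected_iff.1 hE _ ((hasBasis_uniformity E x₀).mem_of_mem ⟨F.2, h⟩) _ a)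
  exact ⟨mk F β, hβ⟩

/-- A point of `X_E` that lifts to `X̃` is, by compatibility of the coordinates, the class of an
`F`-chain for every entourage `F ⊆ E`. -/
theorem chainConnected_of_proj_surjective
    (hE : Function.Surjective (XTilde.proj E : XTilde x₀ → XE E x₀)) :
    ChainConnected (XE E x₀) := by
  refine chainConnected_of_hasBasis (hasBasis_uniformity E x₀) (mk E (EChain.single E.1 x₀)) ?_
  rintro F ⟨hF, h⟩ a
  obtain ⟨t, rfl⟩ := hE a
  obtain ⟨β, hβ⟩ := Quotient.exists_rep (t.1 ⟨F, hF⟩)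
  have ht : mk E (β.map h) = XTilde.proj E t := by
    rw [XTilde.proj, ← t.2 E ⟨F, hF⟩ h, ← hβ]
    rfl
  rw [← ht]
  exact reflTransGen_star_mk_map hF h β

end XE

/-! ### Covering bases -/

theorem IsCoveringBasis.proj_surjective {B : Set (Entourage X)} (hB : IsCoveringBasis x₀ B)
    (hE : ChainConnected (XE E x₀)) :
    Function.Surjective (XTilde.proj E : XTilde x₀ → XE E x₀) := by
  obtain ⟨F, hF, h⟩ := hB.1.mem_iff.1 E.2
  intro a
  obtain ⟨b, rfl⟩ := XE.map_surjective_of_chainConnected hE h a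
  obtain ⟨t, rfl⟩ := hB.2 F hF b
  exact ⟨t, (t.2 E F h).symm⟩

theorem IsCoveringBasis.insert {B : Set (Entourage X)} (hB : IsCoveringBasis x₀ B)
    (hE : Function.Surjective (XTilde.proj E : XTilde x₀ → XE E x₀)) :
    IsCoveringBasis x₀ (insert E B) := by
  refine ⟨⟨fun t => ⟨fun ht => ?_, fun ⟨G, _, hG⟩ => mem_of_superset G.2 hG⟩⟩, ?_⟩
  · obtain ⟨F, hF, h⟩ := hB.1.mem_iff.1 ht
    exact ⟨F, mem_insert_of_mem _ hF, h⟩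
  · rintro F (rfl | hF)
    exacts [hE, hB.2 F hF]

end Coverable

theorem mainTheorem5 {X : Type*} [UniformSpace X] (x₀ : X) (hX : IsCoverable x₀)
    (E : Entourage X) :
    IsCoveringEntourage x₀ E ↔ ChainConnected (XE E x₀) := by
  constructor
  · rintro ⟨B, hB, hE⟩
    exact XE.chainConnected_of_proj_surjective (hB.2 E hE)
  · intro hE
    obtain ⟨-, B, hB⟩ := hX
    exact ⟨insert E B, hB.insert (hB.proj_surjective hE), mem_insert E B⟩
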